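/- Let $G=(V,E)$ be a finite simple triangle-free graph with an edge-weight function $w:E\to\mathbb{R}_{\ge 0}$, let $\Delta\ge 0$ be an integer such that every vertex of $G$ has degree at most $\Delta$, and let $M$ be a matching in $G$. For a set (or subgraph) $F$ of edges write $w(F)=\sum_{e\in F}w(e)$, let $w(G)=w(E)$, and let $\mathrm{mac}(G)$ denote the maximum weight of a cut of $G$, i.e. the maximum over all $A\subseteq V$ of the total weight of the edges of $G$ with exactly one end in $A$. Then $$\mathrm{mac}(G)\;\ge\;\frac{\Delta}{2\Delta-1}\,\bigl(w(G)-w(M)\bigr)+w(M).$$ -/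

import Mathlib

namespace MaxCut

variable {V : Type*} [Finite V]

/-- The total weight `w(S) = ∑ e ∈ S, w e` of a set `S` of edges. -/
noncomputable def weight (w : Sym2 V → ℝ) (S : Set (Sym2 V)) : ℝ :=
  ∑ e ∈ S.toFinite.toFinset, w e

/-- The weight of the cut `(A, V \ A)` of `G`, that is, of the bipartite subgraph formed by the
edges of `G` with one end in `A` and the other end outside `A`. -/
noncomputable def cutWeight (G : SimpleGraph V) (w : Sym2 V → ℝ) (A : Set V) : ℝ :=
  weight w (G.between A Aᶜ).edgeSet

/-- The maximum weight of a cut of the finite weighted graph `(G, w)`. -/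
noncomputable def mac (G : SimpleGraph V) (w : Sym2 V → ℝ) : ℝ :=
  ⨆ A : Set V, cutWeight G w A

/-- The supremum in the definition of `mac` is a maximum. -/
theorem isGreatest_mac (G : SimpleGraph V) (w : Sym2 V → ℝ) :
    IsGreatest (Set.range (cutWeight G w)) (mac G w) := by
  obtain ⟨A, hA⟩ := exists_eq_ciSup_of_finite (f := cutWeight G w)
  refine ⟨⟨A, hA⟩, ?_⟩
  rintro _ ⟨B, rfl⟩
  exact le_ciSup (Set.finite_range (cutWeight G w)).bddAbove B

end MaxCut

/-!
Let `m` be the involution exchanging the ends of every edge of `M`, and let `H` be obtained from `G`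
by contracting the edges of `M`. If `2 ≤ Δ`, then `H` has maximum degree at most `2 * Δ - 2`, so by
Vizing's theorem its edges split into `2 * Δ - 1` matchings. Contracting one of these as well
partitions `V` into blocks of at most four vertices, and a triangle-free graph on at most four
vertices is bipartite. Choosing a bipartition of each block and exchanging its two sides
independently at random gives a cut containing every edge inside a block and half of the other
edges on average. Every edge of `M` lies inside a block for all `2 * Δ - 1` matchings and every
other edge for exactly one of them; averaging over the matchings gives the bound.

Vizing's theorem is proved by induction on the graph, adding a vertex `v` to a coloured graph.
Keep a list of one missing colour at one neighbour of `v` and of two missing colours at the others.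
Exchanging two colours along an alternating path changes the lists at no more than two vertices, so
the sum of the squares of the numbers of lists containing each colour decreases unless these numbers
are nearly equal; since there are fewer than `2 * #C` list entries and their number is odd, some
colour then lies in exactly one list.
-/

namespace MaxCut

open Finset Function

section Involution

variable {V : Type*} {m : V → V}

/-- The graph joining every non-fixed point `x` of an involution `m` to `m x`: its edges form a
matching, and every matching arises in this way. -/
def mateGraph (m : V → V) : SimpleGraph V :=
  SimpleGraph.fromRel fun x y => m x = y

theorem mateGraph_adj (hm : Involutive m) {x y : V} :
    (mateGraph m).Adj x y ↔ x ≠ y ∧ m x = y := by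
  rw [mateGraph, SimpleGraph.fromRel_adj, hm.eq_iff, eq_comm (a := x) (b := m y), or_self,
    hm.eq_iff, eq_comm]

theorem exists_involutive_mateGraph_eq (K : SimpleGraph V)
    (hK : ∀ x, (K.neighborSet x).Subsingleton) :
    ∃ m : V → V, Involutive m ∧ mateGraph m = K := by
  classical
  let m : V → V := fun x => if h : (K.neighborSet x).Nonempty then h.some else x
  have m_of_adj {x y : V} (h : K.Adj x y) : m x = y := by
    have hne : (K.neighborSet x).Nonempty := ⟨y, h⟩
    simpa only [m, dif_pos hne] using hK x hne.some_mem h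
  have adj_of_ne {x : V} (h : m x ≠ x) : K.Adj x (m x) := by
    by_cases hne : (K.neighborSet x).Nonempty
    · simp only [m, dif_pos hne]
      exact hne.some_mem
    · exact absurd (dif_neg hne) h
  have hm : Involutive m := fun x => by
    by_cases h : m x = x
    · rw [h, h]
    · exact m_of_adj (adj_of_ne h).symm
  refine ⟨m, hm, ?_⟩
  ext x y
  rw [mateGraph_adj hm]
  refine ⟨?_, fun h => ⟨h.ne, m_of_adj h⟩⟩
  rintro ⟨hne, rfl⟩
  exact adj_of_ne hne.symm

section SwapComp

variable [DecidableEq V] {u v : V}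

theorem involutive_swap_comp (hm : Involutive m) (hu : m u = u) (hv : m v = v) :
    Involutive (Equiv.swap u v ∘ m) := by
  intro x
  have hcomm : m (Equiv.swap u v (m x)) = Equiv.swap u v (m (m x)) := by
    rw [hm.injective.map_swap, hu, hv]
  simp only [comp_apply, hcomm, hm x, Equiv.swap_apply_self]

theorem mateGraph_swap_comp (hm : Involutive m) (hu : m u = u) (hv : m v = v) :
    mateGraph (Equiv.swap u v ∘ m) = mateGraph m ⊔ SimpleGraph.edge u v := by
  ext x y
  have hfix {z : V} (hz : m z = z) : m x = z ↔ x = z := by rw [hm.eq_iff, hz]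
  simp only [mateGraph_adj hm, mateGraph_adj (involutive_swap_comp hm hu hv), SimpleGraph.sup_adj,
    SimpleGraph.edge_adj, comp_apply]
  by_cases hxu : x = u
  · subst hxu; rw [hu, Equiv.swap_apply_left]; grind
  by_cases hxv : x = v
  · subst hxv; rw [hv, Equiv.swap_apply_right]; grind
  rw [Equiv.swap_apply_of_ne_of_ne (by rwa [Ne, hfix hu]) (by rwa [Ne, hfix hv])]
  grind

end SwapComp

/-- The block of `x` in the partition of `V` into the orbits of the involution `m`; contracting the
matching given by `m` means identifying vertices with the same block. -/
def mateBlock (m : V → V) (x : V) : Sym2 V := s(x, m x)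

theorem mateBlock_eq_iff (hm : Involutive m) {x y : V} :
    mateBlock m x = mateBlock m y ↔ x = y ∨ m x = y := by
  rw [mateBlock, mateBlock, Sym2.eq_iff]
  have := hm x
  grind

theorem ncard_preimage_mateBlock_comp_le {U : Type*} [Finite U] (q : U → V) {k : ℕ}
    (hq : ∀ x, (q ⁻¹' {x}).ncard ≤ k) (m : V → V) (P : Sym2 V) :
    (mateBlock m ∘ q ⁻¹' {P}).ncard ≤ 2 * k := by
  induction P using Sym2.ind with
  | _ x y =>
  have hsub : mateBlock m ∘ q ⁻¹' {s(x, y)} ⊆ q ⁻¹' {x} ∪ q ⁻¹' {y} := by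
    intro u hu
    have hmem : q u ∈ s(x, y) := hu ▸ Sym2.mem_mk_left _ _
    exact Sym2.mem_iff.1 hmem
  calc (mateBlock m ∘ q ⁻¹' {s(x, y)}).ncard
      ≤ (q ⁻¹' {x} ∪ q ⁻¹' {y}).ncard := Set.ncard_le_ncard hsub
    _ ≤ (q ⁻¹' {x}).ncard + (q ⁻¹' {y}).ncard := Set.ncard_union_le _ _
    _ ≤ 2 * k := by linarith [hq x, hq y]

end Involution

section KempeSet

variable {V : Type*} {a b : Equiv.Perm V}

theorem apply_zpow_mul_apply_of_fixed (ha : Involutive a) (hb : Involutive b) {x : V}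
    (hx : a x = x) (n : ℤ) : a (((a * b) ^ n) x) = ((a * b) ^ (-n)) x := by
  have hconj : SemiconjBy a (a * b) (a * b)⁻¹ := by
    ext z
    simp [Equiv.Perm.inv_def, Equiv.eq_symm_apply, ha _, hb _]
  have hpow := congrArg (fun p : Equiv.Perm V => p x) (hconj.zpow_right n).eq
  rw [inv_zpow'] at hpow
  simpa only [Equiv.Perm.mul_apply, hx] using hpow

theorem dvd_sub_of_dvd_two_mul {p m n : ℤ} (hm : p ∣ 2 * m) (hn : p ∣ 2 * n) (hm' : ¬ p ∣ m)
    (hn' : ¬ p ∣ n) : p ∣ m - n := by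
  have odd_of {k s : ℤ} (hk : ¬ p ∣ k) (hs : 2 * k = p * s) : Odd s := by
    rw [← Int.not_even_iff_odd]
    rintro ⟨t, rfl⟩
    exact hk ⟨t, by linarith⟩
  obtain ⟨s, hs⟩ := hm
  obtain ⟨t, ht⟩ := hn
  obtain ⟨r, hr⟩ := (odd_of hm' hs).sub_odd (odd_of hn' ht)
  have hsub : 2 * (m - n) = p * (s - t) := by linarith
  exact ⟨r, by rw [hr] at hsub; linarith⟩

theorem card_fixed_sameCycle_le_two (ha : Involutive a) (hb : Involutive b) (x : V)
    (T : Finset V) (hT : ∀ y ∈ T, a y = y ∧ (a * b).SameCycle x y) (hx : x ∈ T) : #T ≤ 2 := by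
  classical
  set p : ℤ := (minimalPeriod ((a * b) • ·) x : ℤ)
  have dvd_iff (n : ℤ) : ((a * b) ^ n) x = x ↔ p ∣ n := by
    rw [← Equiv.Perm.smul_def, MulAction.zpow_smul_eq_iff_minimalPeriod_dvd]
  -- A fixed point `(a * b) ^ n x` equals `(a * b) ^ (-n) x`, so `n` is `0` or `p / 2` modulo `p`.
  have dvd_two_mul {n : ℤ} (hn : a (((a * b) ^ n) x) = ((a * b) ^ n) x) : p ∣ 2 * n := by
    rw [apply_zpow_mul_apply_of_fixed ha hb (hT x hx).1, zpow_neg, Equiv.Perm.inv_eq_iff_eq,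
      ← Equiv.Perm.mul_apply, ← zpow_add, ← two_mul] at hn
    exact (dvd_iff _).1 hn.symm
  have hle : #(T.erase x) ≤ 1 := by
    refine Finset.card_le_one.2 fun y hy z hz => ?_
    obtain ⟨hyx, hyT⟩ := mem_erase.1 hy
    obtain ⟨hzx, hzT⟩ := mem_erase.1 hz
    obtain ⟨hay, m, rfl⟩ := hT y hyT
    obtain ⟨haz, n, rfl⟩ := hT z hzT
    have hdvd := dvd_sub_of_dvd_two_mul (dvd_two_mul hay) (dvd_two_mul haz)
      (mt (dvd_iff m).2 hyx) (mt (dvd_iff n).2 hzx)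
    rw [← dvd_iff, sub_eq_neg_add, zpow_add, zpow_neg, Equiv.Perm.mul_apply,
      Equiv.Perm.inv_eq_iff_eq] at hdvd
    exact hdvd
  rw [card_erase_of_mem hx] at hle
  omega

theorem exists_invariant_card_filter_lt_le_two [Finite V] [DecidableEq V] {f g : V → V}
    (hf : Involutive f) (hg : Involutive g) (X Y : Finset V) (hX : ∀ x ∈ X, f x = x)
    (hlt : #Y < #X) :
    ∃ S : Finset V, (∀ x, f x ∈ S ↔ x ∈ S) ∧ (∀ x, g x ∈ S ↔ x ∈ S) ∧
      #{y ∈ Y | y ∈ S} < #{x ∈ X | x ∈ S} ∧ #{x ∈ X | x ∈ S} ≤ 2 := by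
  classical
  have := Fintype.ofFinite V
  -- The cycle of `r` through a fixed point `x` of `f` is the alternating path that starts at `x`.
  let r : Equiv.Perm V := hf.toPerm * hg.toPerm
  let cycle : V → Quotient (Equiv.Perm.SameCycle.setoid r) := Quotient.mk _
  obtain ⟨c, -, hc⟩ : ∃ c ∈ univ, #{y ∈ Y | cycle y = c} < #{x ∈ X | cycle x = c} := by
    refine exists_lt_of_sum_lt ?_
    rwa [← card_eq_sum_card_fiberwise (by simp), ← card_eq_sum_card_fiberwise (by simp)]
  obtain ⟨x, hx⟩ := card_pos.1 (Nat.zero_lt_of_lt hc)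
  obtain ⟨hxX, rfl⟩ := mem_filter.1 hx
  have cycle_eq {y : V} : cycle y = cycle x ↔ r.SameCycle x y :=
    Quotient.eq.trans Equiv.Perm.sameCycle_comm
  have sameCycle_f {y : V} (hy : r.SameCycle x y) : r.SameCycle x (f y) := by
    obtain ⟨n, rfl⟩ := hy
    exact ⟨-n, (apply_zpow_mul_apply_of_fixed hf hg (hX x hxX) n).symm⟩
  have sameCycle_g {y : V} (hy : r.SameCycle x y) : r.SameCycle x (g y) := by
    have hgy : g y = f (r y) := (hf (g y)).symm
    rw [hgy]
    exact sameCycle_f (Equiv.Perm.sameCycle_apply_right.2 hy)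
  refine ⟨({y | cycle y = cycle x} : Finset V), fun y => ?_, fun y => ?_, by simpa using hc, ?_⟩
  · simp only [mem_filter_univ, cycle_eq]
    exact ⟨fun h => hf y ▸ sameCycle_f h, sameCycle_f⟩
  · simp only [mem_filter_univ, cycle_eq]
    exact ⟨fun h => hg y ▸ sameCycle_g h, sameCycle_g⟩
  · refine card_fixed_sameCycle_le_two (a := hf.toPerm) (b := hg.toPerm) hf hg x _
      (fun y hy => ?_) (by simpa using hxX)
    simp only [mem_filter, mem_univ, true_and, cycle_eq] at hy
    exact ⟨hX y hy.1, hy.2⟩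

end KempeSet

section Between

variable {V : Type*}

theorem between_empty (G : SimpleGraph V) (s : Set V) : G.between s ∅ = ⊥ := by
  ext x y
  simp [SimpleGraph.between_adj]

theorem between_singleton_eq_sup_edge [DecidableEq V] {u v : V} {N : Finset V} (hu : u ∈ N) :
    (⊤ : SimpleGraph V).between {v} N =
      (⊤ : SimpleGraph V).between {v} (N.erase u) ⊔ SimpleGraph.edge u v := by
  ext x y
  simp only [SimpleGraph.sup_adj, SimpleGraph.between_adj, SimpleGraph.edge_adj,
    SimpleGraph.top_adj, Set.mem_singleton_iff, mem_coe, mem_erase]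
  grind

theorem deleteIncidenceSet_sup_between_neighborSet (H : SimpleGraph V) (v : V) :
    H.deleteIncidenceSet v ⊔ (⊤ : SimpleGraph V).between {v} (H.neighborSet v) = H := by
  ext x y
  simp only [SimpleGraph.sup_adj, SimpleGraph.deleteIncidenceSet_adj, SimpleGraph.between_adj,
    SimpleGraph.top_adj, Set.mem_singleton_iff, SimpleGraph.mem_neighborSet]
  grind [SimpleGraph.Adj.symm, SimpleGraph.Adj.ne]

end Between

section Vizing

variable {V ι : Type*}

/-- A proper edge colouring of `H` with colours in `C`. For a colour `i ∈ C`, `mate i x` is the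
other end of the edge of colour `i` at `x`, or `x` itself if there is no such edge; the values
`mate i` for `i ∉ C` carry no information. -/
structure EdgeColoring (H : SimpleGraph V) (C : Finset ι) where
  mate : ι → V → V
  involutive (i : ι) : Involutive (mate i)
  adj_mate {i : ι} {x : V} (hi : i ∈ C) (hx : mate i x ≠ x) : H.Adj x (mate i x)
  existsUnique_mate_eq {x y : V} (h : H.Adj x y) : ∃! i, i ∈ C ∧ mate i x = y

namespace EdgeColoring

variable {H : SimpleGraph V} {C : Finset ι}

theorem mate_eq_self (c : EdgeColoring H C) {v : V} (hv : ∀ y, ¬ H.Adj v y) {i : ι} (hi : i ∈ C) :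
    c.mate i v = v :=
  not_not.1 fun h => hv _ (c.adj_mate hi h)

theorem mateGraph_mate_le (c : EdgeColoring H C) {i : ι} (hi : i ∈ C) :
    mateGraph (c.mate i) ≤ H := by
  intro x y h
  obtain ⟨hne, rfl⟩ := (mateGraph_adj (c.involutive i)).1 h
  exact c.adj_mate hi hne.symm

section Missing

variable [DecidableEq V]

/-- The colours of `C` that occur on no edge at `u`. -/
def missing (c : EdgeColoring H C) (u : V) : Finset ι := {i ∈ C | c.mate i u = u}

theorem mem_missing {c : EdgeColoring H C} {u : V} {i : ι} :
    i ∈ c.missing u ↔ i ∈ C ∧ c.mate i u = u :=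
  mem_filter

theorem card_missing_add_ncard_neighborSet (c : EdgeColoring H C) (u : V) :
    #(c.missing u) + (H.neighborSet u).ncard = #C := by
  have himage : H.neighborSet u = (c.mate · u) '' ({i ∈ C | c.mate i u ≠ u} : Finset ι) := by
    ext y
    simp only [SimpleGraph.mem_neighborSet, coe_filter, Set.mem_image, Set.mem_ofPred_eq]
    constructor
    · intro h
      obtain ⟨i, ⟨hi, rfl⟩, -⟩ := c.existsUnique_mate_eq h
      exact ⟨i, ⟨hi, h.ne'⟩, rfl⟩
    · rintro ⟨i, ⟨hi, hne⟩, rfl⟩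
      exact c.adj_mate hi hne
  have hinj : Set.InjOn (c.mate · u) ({i ∈ C | c.mate i u ≠ u} : Finset ι) := by
    intro i hi j hj hij
    obtain ⟨hiC, hne⟩ := mem_filter.1 hi
    exact (c.existsUnique_mate_eq (c.adj_mate hiC hne)).unique ⟨hiC, rfl⟩
      ⟨(mem_filter.1 hj).1, hij.symm⟩
  rw [himage, hinj.ncard_image, Set.ncard_coe_finset, missing,
    card_filter_add_card_filter_not]

end Missing

section Kempe

variable [DecidableEq V] [DecidableEq ι] {i j : ι} {S : Finset V}

/-- The permutation of the colours at the vertex `x` when the colours `i` and `j` are exchanged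
on `S`. -/
def kempePerm (i j : ι) (S : Finset V) (x : V) : Equiv.Perm ι :=
  if x ∈ S then Equiv.swap i j else 1

theorem mem_map_kempePerm {x : V} {s : Finset ι} {l : ι} :
    l ∈ s.map (kempePerm i j S x).toEmbedding ↔ kempePerm i j S x l ∈ s := by
  rw [mem_map_equiv]
  unfold kempePerm
  split_ifs
  · rw [Equiv.symm_swap]
  · rfl

theorem kempePerm_mem_iff (hi : i ∈ C) (hj : j ∈ C) (x : V) {l : ι} :
    kempePerm i j S x l ∈ C ↔ l ∈ C := by
  unfold kempePerm
  split_ifs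
  · grind
  · rfl

theorem kempePerm_mate_apply (c : EdgeColoring H C) (hSi : ∀ x, c.mate i x ∈ S ↔ x ∈ S)
    (hSj : ∀ x, c.mate j x ∈ S ↔ x ∈ S) (l : ι) (x : V) :
    kempePerm i j S (c.mate (kempePerm i j S x l) x) l = kempePerm i j S x l := by
  by_cases hl : l = i ∨ l = j
  · have hmem : c.mate (kempePerm i j S x l) x ∈ S ↔ x ∈ S := by
      rcases hl with rfl | rfl <;> by_cases hx : x ∈ S <;> simp [kempePerm, hx, hSi, hSj]
    exact DFunLike.congr_fun (if_congr hmem rfl rfl) l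
  · obtain ⟨hli, hlj⟩ := not_or.1 hl
    have hfix (y : V) : kempePerm i j S y l = l := by
      unfold kempePerm
      split_ifs
      · exact Equiv.swap_apply_of_ne_of_ne hli hlj
      · rfl
    rw [hfix, hfix]

/-- The colouring in which the colours `i` and `j` are exchanged on the edges inside `S`, where no
edge of colour `i` or `j` leaves `S`. -/
def kempeSwap (c : EdgeColoring H C) (hi : i ∈ C) (hj : j ∈ C)
    (hSi : ∀ x, c.mate i x ∈ S ↔ x ∈ S) (hSj : ∀ x, c.mate j x ∈ S ↔ x ∈ S) :
    EdgeColoring H C where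
  mate l x := c.mate (kempePerm i j S x l) x
  involutive l x := by
    simp only [kempePerm_mate_apply c hSi hSj]
    exact c.involutive _ x
  adj_mate hl := c.adj_mate ((kempePerm_mem_iff hi hj _).2 hl)
  existsUnique_mate_eq {x y} h := by
    simpa only [kempePerm_mem_iff hi hj] using
      (kempePerm i j S x).bijective.existsUnique_iff.1 (c.existsUnique_mate_eq h)

theorem missing_kempeSwap (c : EdgeColoring H C) (hi : i ∈ C) (hj : j ∈ C)
    (hSi : ∀ x, c.mate i x ∈ S ↔ x ∈ S) (hSj : ∀ x, c.mate j x ∈ S ↔ x ∈ S) (u : V) :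
    (c.kempeSwap hi hj hSi hSj).missing u =
      (c.missing u).map (kempePerm i j S u).toEmbedding := by
  ext l
  rw [mem_map_kempePerm, mem_missing, mem_missing, kempePerm_mem_iff hi hj]
  rfl

end Kempe

section Holders

variable [DecidableEq ι]

/-- The vertices of `N` whose list contains the colour `i`. -/
def holders (N : Finset V) (A : V → Finset ι) (i : ι) : Finset V := {u ∈ N | i ∈ A u}

theorem mem_holders {N : Finset V} {A : V → Finset ι} {i : ι} {u : V} :
    u ∈ holders N A i ↔ u ∈ N ∧ i ∈ A u :=
  mem_filter

theorem sum_card_holders {N : Finset V} {A : V → Finset ι} (hA : ∀ u ∈ N, A u ⊆ C) :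
    ∑ i ∈ C, #(holders N A i) = ∑ u ∈ N, #(A u) := by
  refine (sum_card_bipartiteAbove_eq_sum_card_bipartiteBelow fun i u => i ∈ A u).trans ?_
  refine sum_congr rfl fun u hu => congrArg card ?_
  rw [bipartiteBelow, filter_mem_eq_inter, inter_eq_right.2 (hA u hu)]

theorem card_holders_map_kempePerm [DecidableEq V] {i j : ι} {S N : Finset V} (A : V → Finset ι)
    (l : ι) :
    #(holders N (fun u => (A u).map (kempePerm i j S u).toEmbedding) l) =
      #{u ∈ holders N A (Equiv.swap i j l) | u ∈ S} + #{u ∈ holders N A l | u ∉ S} := by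
  rw [← card_filter_add_card_filter_not (p := (· ∈ S))]
  simp only [holders, mem_map_kempePerm, filter_filter]
  congr 2 <;> refine filter_congr fun u _ => and_congr_left fun hu => ?_
  · rw [kempePerm, if_pos hu]
  · rw [kempePerm, if_neg hu, Equiv.Perm.one_apply]

theorem sum_sq_card_holders_map_kempePerm_lt [DecidableEq V] {i j : ι} {S N : Finset V}
    {A : V → Finset ι} (hi : i ∈ C) (hj : j ∈ C) (hij : #(holders N A j) + 2 < #(holders N A i))
    (hlt : #{u ∈ holders N A j | u ∈ S} < #{u ∈ holders N A i | u ∈ S})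
    (hle : #{u ∈ holders N A i | u ∈ S} ≤ 2) :
    ∑ l ∈ C, #(holders N (fun u => (A u).map (kempePerm i j S u).toEmbedding) l) ^ 2 <
      ∑ l ∈ C, #(holders N A l) ^ 2 := by
  have hne : i ≠ j := by
    rintro rfl
    omega
  have hji : j ∈ C.erase i := mem_erase.2 ⟨hne.symm, hj⟩
  simp only [card_holders_map_kempePerm, ← add_sum_erase C _ hi, ← add_sum_erase _ _ hji]
  have hrest : ∀ l ∈ (C.erase i).erase j,
      (#{u ∈ holders N A (Equiv.swap i j l) | u ∈ S} + #{u ∈ holders N A l | u ∉ S}) ^ 2 =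
        #(holders N A l) ^ 2 := by
    intro l hl
    obtain ⟨hlj, hli, -⟩ := by simpa only [mem_erase] using hl
    rw [Equiv.swap_apply_of_ne_of_ne hli hlj, card_filter_add_card_filter_not]
  rw [sum_congr rfl hrest, Equiv.swap_apply_left, Equiv.swap_apply_right]
  rw [← card_filter_add_card_filter_not (s := holders N A i) (p := (· ∈ S)),
    ← card_filter_add_card_filter_not (s := holders N A j) (p := (· ∈ S))] at hij ⊢
  nlinarith

theorem exists_card_holders_le_one {N : Finset V} {A : V → Finset ι} (hA : ∀ u ∈ N, A u ⊆ C)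
    (hlt : ∑ u ∈ N, #(A u) < 2 * #C) : ∃ j ∈ C, #(holders N A j) ≤ 1 := by
  have hsum : ∑ i ∈ C, #(holders N A i) < ∑ _i ∈ C, 2 := by
    rw [sum_card_holders hA, sum_const, smul_eq_mul]
    linarith
  obtain ⟨j, hj, hlt⟩ := exists_lt_of_sum_lt hsum
  exact ⟨j, hj, Nat.le_of_lt_succ hlt⟩

theorem exists_odd_card_holders {N : Finset V} {A : V → Finset ι} (hA : ∀ u ∈ N, A u ⊆ C)
    (hodd : Odd (∑ u ∈ N, #(A u))) : ∃ i ∈ C, Odd #(holders N A i) := by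
  by_contra! h
  rw [← sum_card_holders hA, ← Nat.not_even_iff_odd] at hodd
  exact hodd (even_sum _ fun i hi => Nat.not_odd_iff_even.1 (h i hi))

variable [Finite V] [DecidableEq V]

theorem exists_sum_sq_card_holders_lt (c : EdgeColoring H C)
    {N : Finset V} {A : V → Finset ι} (hA : ∀ u ∈ N, A u ⊆ c.missing u) {i j : ι} (hi : i ∈ C)
    (hj : j ∈ C) (hij : #(holders N A j) + 2 < #(holders N A i)) :
    ∃ (c' : EdgeColoring H C) (A' : V → Finset ι), (∀ u ∈ N, A' u ⊆ c'.missing u) ∧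
      (∀ u, #(A' u) = #(A u)) ∧
      ∑ l ∈ C, #(holders N A' l) ^ 2 < ∑ l ∈ C, #(holders N A l) ^ 2 := by
  have hfixed : ∀ u ∈ holders N A i, c.mate i u = u := fun u hu =>
    (mem_missing.1 (hA u (mem_holders.1 hu).1 (mem_holders.1 hu).2)).2
  obtain ⟨S, hSi, hSj, hlt, hle⟩ := exists_invariant_card_filter_lt_le_two (c.involutive i)
    (c.involutive j) _ _ hfixed (by omega : #(holders N A j) < #(holders N A i))
  refine ⟨c.kempeSwap hi hj hSi hSj, fun u => (A u).map (kempePerm i j S u).toEmbedding,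
    fun u hu => ?_, fun u => card_map _, sum_sq_card_holders_map_kempePerm_lt hi hj hij hlt hle⟩
  rw [missing_kempeSwap]
  exact map_subset_map.2 (hA u hu)

theorem exists_card_holders_eq_one (c : EdgeColoring H C) {N : Finset V} {A : V → Finset ι}
    (hA : ∀ u ∈ N, A u ⊆ c.missing u) (hodd : Odd (∑ u ∈ N, #(A u)))
    (hlt : ∑ u ∈ N, #(A u) < 2 * #C) :
    ∃ (c' : EdgeColoring H C) (A' : V → Finset ι), (∀ u ∈ N, A' u ⊆ c'.missing u) ∧
      (∀ u, #(A' u) = #(A u)) ∧ ∃ i ∈ C, #(holders N A' i) = 1 := by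
  induction hn : ∑ l ∈ C, #(holders N A l) ^ 2 using Nat.strong_induction_on generalizing c A with
  | _ n ih =>
  have hAC : ∀ u ∈ N, A u ⊆ C := fun u hu => (hA u hu).trans (filter_subset _ _)
  obtain ⟨j, hj, hj_le⟩ := exists_card_holders_le_one hAC hlt
  by_cases hbig : ∃ i ∈ C, #(holders N A j) + 2 < #(holders N A i)
  · obtain ⟨i, hi, hij⟩ := hbig
    obtain ⟨c₁, A₁, hA₁, hcard₁, hlt₁⟩ := exists_sum_sq_card_holders_lt c hA hi hj hij
    obtain ⟨c₂, A₂, hA₂, hcard₂, hone⟩ :=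
      ih _ (hn ▸ hlt₁) c₁ hA₁ (by simpa only [hcard₁]) (by simpa only [hcard₁]) rfl
    exact ⟨c₂, A₂, hA₂, fun u => (hcard₂ u).trans (hcard₁ u), hone⟩
  · refine ⟨c, A, hA, fun _ => rfl, ?_⟩
    obtain ⟨i, hi, k, hk⟩ := exists_odd_card_holders hAC hodd
    have hi_le : #(holders N A i) ≤ #(holders N A j) + 2 := not_lt.1 fun h => hbig ⟨i, hi, h⟩
    rcases Nat.le_one_iff_eq_zero_or_eq_one.1 hj_le with hj_zero | hj_one
    · exact ⟨i, hi, by omega⟩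
    · exact ⟨j, hj, hj_one⟩

end Holders

section AddColor

variable [DecidableEq ι]

/-- The colouring of the remaining edges when the colour class `i` is removed. -/
def eraseColor (c : EdgeColoring H C) (i : ι) (hi : i ∈ C) :
    EdgeColoring (H \ mateGraph (c.mate i)) (C.erase i) where
  mate := c.mate
  involutive := c.involutive
  adj_mate {l x} hl hx := by
    obtain ⟨hli, hlC⟩ := mem_erase.1 hl
    have hadj := c.adj_mate hlC hx
    refine (SimpleGraph.sdiff_adj _ _ _ _).2 ⟨hadj, fun h => hli ?_⟩
    exact (c.existsUnique_mate_eq hadj).unique ⟨hlC, rfl⟩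
      ⟨hi, ((mateGraph_adj (c.involutive i)).1 h).2⟩
  existsUnique_mate_eq {x y} h := by
    obtain ⟨hadj, hnot⟩ := (SimpleGraph.sdiff_adj _ _ _ _).1 h
    obtain ⟨l, ⟨hlC, hl⟩, huniq⟩ := c.existsUnique_mate_eq hadj
    refine ⟨l, ⟨mem_erase.2 ⟨?_, hlC⟩, hl⟩, fun k hk => huniq k ⟨mem_of_mem_erase hk.1, hk.2⟩⟩
    rintro rfl
    exact hnot ((mateGraph_adj (c.involutive l)).2 ⟨hadj.ne, hl⟩)

theorem missing_eraseColor [DecidableEq V] (c : EdgeColoring H C) {i : ι} (hi : i ∈ C) (u : V) :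
    (c.eraseColor i hi).missing u = (c.missing u).erase i :=
  filter_erase _ _ _

/-- The extension of a colouring by a new colour class `i`, given by the involution `ρ`. -/
def addColor {i : ι} (c : EdgeColoring H (C.erase i)) (hi : i ∈ C) {ρ : V → V}
    (hρ : Involutive ρ) (hdisj : Disjoint H (mateGraph ρ)) :
    EdgeColoring (H ⊔ mateGraph ρ) C where
  mate := update c.mate i ρ
  involutive l := by
    obtain rfl | hl := eq_or_ne l i
    · rwa [update_self]
    · rw [update_of_ne hl]
      exact c.involutive l
  adj_mate {l x} hl hx := by
    obtain rfl | hli := eq_or_ne l i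
    · rw [update_self] at hx ⊢
      exact Or.inr ((mateGraph_adj hρ).2 ⟨hx.symm, rfl⟩)
    · rw [update_of_ne hli] at hx ⊢
      exact Or.inl (c.adj_mate (mem_erase.2 ⟨hli, hl⟩) hx)
  existsUnique_mate_eq {x y} h := by
    have not_both (h₁ : H.Adj x y) (h₂ : ρ x = y) : False :=
      SimpleGraph.disjoint_left.1 hdisj x y h₁ ((mateGraph_adj hρ).2 ⟨h₁.ne, h₂⟩)
    rcases h with h | h
    · obtain ⟨l, ⟨hl, hxy⟩, huniq⟩ := c.existsUnique_mate_eq h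
      obtain ⟨hli, hlC⟩ := mem_erase.1 hl
      refine ⟨l, ⟨hlC, by rwa [update_of_ne hli]⟩, fun k ⟨hkC, hk⟩ => ?_⟩
      obtain rfl | hki := eq_or_ne k i
      · rw [update_self] at hk
        exact (not_both h hk).elim
      · rw [update_of_ne hki] at hk
        exact huniq k ⟨mem_erase.2 ⟨hki, hkC⟩, hk⟩
    · obtain ⟨hne, hxy⟩ := (mateGraph_adj hρ).1 h
      refine ⟨i, ⟨hi, by rwa [update_self]⟩, fun k ⟨hkC, hk⟩ => by_contra fun hki => ?_⟩
      rw [update_of_ne hki] at hk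
      have hadj := c.adj_mate (mem_erase.2 ⟨hki, hkC⟩) (hk.trans_ne hne.symm)
      exact not_both (hk ▸ hadj) hxy

theorem exists_mem_missing_le_card_erase [Finite V] [DecidableEq V] (c : EdgeColoring H C)
    {N : Finset V} (hne : N.Nonempty) (hN : #N ≤ #C) {u₀ : V}
    (hc : ∀ u ∈ N, (if u = u₀ then 1 else 2) ≤ #(c.missing u)) :
    ∃ (c' : EdgeColoring H C) (i : ι) (u u₁ : V), u ∈ N ∧ i ∈ c'.missing u ∧
      ∀ x ∈ N.erase u, (if x = u₁ then 1 else 2) ≤ #((c'.missing x).erase i) := by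
  obtain ⟨u₁, hu₁, hc₁⟩ : ∃ u₁ ∈ N, ∀ u ∈ N, (if u = u₁ then 1 else 2) ≤ #(c.missing u) := by
    by_cases h : u₀ ∈ N
    · exact ⟨u₀, h, hc⟩
    · obtain ⟨u₁, hu₁⟩ := hne
      exact ⟨u₁, hu₁, fun u hu => by grind⟩
  choose! A hA hcard using fun u hu => exists_subset_card_eq (hc₁ u hu)
  have hsum : ∑ u ∈ N, #(A u) = 2 * (#N - 1) + 1 := by
    rw [sum_congr rfl hcard, ← add_sum_erase _ _ hu₁, if_pos rfl,
      sum_congr rfl fun u hu => if_neg (ne_of_mem_erase hu), sum_const, card_erase_of_mem hu₁,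
      smul_eq_mul]
    ring
  have hpos := card_pos.2 hne
  obtain ⟨c', A', hA', hcard', i, -, hone⟩ := c.exists_card_holders_eq_one hA
    (by rw [hsum]; exact odd_two_mul_add_one _) (by omega)
  obtain ⟨u, hu⟩ := card_eq_one.1 hone
  have mem_iff (x : V) : x ∈ N ∧ i ∈ A' x ↔ x = u := by
    rw [← mem_holders, hu, mem_singleton]
  obtain ⟨huN, hui⟩ := (mem_iff u).2 rfl
  refine ⟨c', i, u, u₁, huN, hA' u huN hui, fun x hx => ?_⟩
  obtain ⟨hxu, hxN⟩ := mem_erase.1 hx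
  have hix : i ∉ A' x := fun h => hxu ((mem_iff x).1 ⟨hxN, h⟩)
  calc (if x = u₁ then 1 else 2) = #(A' x) := by rw [hcard', hcard x hxN]
    _ ≤ #((c'.missing x).erase i) := card_le_card (subset_erase.2 ⟨hA' x hxN, hix⟩)

theorem nonempty_sup_between_of_eraseColor [DecidableEq V] (c : EdgeColoring H C) {i : ι}
    (hi : i ∈ C) {u v : V} {N : Finset V} (hu : u ∈ N) (hiu : c.mate i u = u)
    (hv : ∀ y, ¬ H.Adj v y)
    (d : EdgeColoring (H \ mateGraph (c.mate i) ⊔ (⊤ : SimpleGraph V).between {v} (N.erase u))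
      (C.erase i)) :
    Nonempty (EdgeColoring (H ⊔ (⊤ : SimpleGraph V).between {v} N) C) := by
  have hm := c.involutive i
  have hiv := c.mate_eq_self hv hi
  have hle := c.mateGraph_mate_le hi
  have hdisj : Disjoint (H \ mateGraph (c.mate i) ⊔ (⊤ : SimpleGraph V).between {v} (N.erase u))
      (mateGraph (c.mate i) ⊔ SimpleGraph.edge u v) := by
    rw [SimpleGraph.disjoint_left]
    intro x y hxy hxy'
    have hH (h : (mateGraph (c.mate i)).Adj x y) : H.Adj x y := hle h
    have hvx (h : x = v) : ¬ H.Adj x y := h ▸ hv y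
    have hvy (h : y = v) : ¬ H.Adj x y := h ▸ fun h' => hv x h'.symm
    simp only [SimpleGraph.sup_adj, SimpleGraph.between_adj, SimpleGraph.edge_adj,
      SimpleGraph.sdiff_adj, SimpleGraph.top_adj, Set.mem_singleton_iff, mem_coe, mem_erase]
      at hxy hxy'
    grind
  rw [← mateGraph_swap_comp hm hiu hiv] at hdisj
  have hgraph : H ⊔ (⊤ : SimpleGraph V).between {v} N =
      H \ mateGraph (c.mate i) ⊔ (⊤ : SimpleGraph V).between {v} (N.erase u) ⊔
        mateGraph (Equiv.swap u v ∘ c.mate i) := by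
    rw [mateGraph_swap_comp hm hiu hiv, between_singleton_eq_sup_edge hu, sup_sup_sup_comm,
      sdiff_sup_cancel hle]
  exact ⟨hgraph ▸ d.addColor hi (involutive_swap_comp hm hiu hiv) hdisj⟩

end AddColor

/-- The induction removes a colour: if `i` is missing at exactly one listed vertex `u`, then `uv`
gets colour `i`, and deleting the class of `i` leaves the lists of the other vertices intact. -/
theorem nonempty_sup_between [Finite V] [DecidableEq V] (c : EdgeColoring H C) {v : V}
    {N : Finset V} (hv : ∀ y, ¬ H.Adj v y) (hN : #N ≤ #C) {u₀ : V}
    (hc : ∀ u ∈ N, (if u = u₀ then 1 else 2) ≤ #(c.missing u)) :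
    Nonempty (EdgeColoring (H ⊔ (⊤ : SimpleGraph V).between {v} N) C) := by
  classical
  induction hk : #N generalizing C N H u₀ with
  | zero =>
    obtain rfl := card_eq_zero.1 hk
    rw [coe_empty, between_empty, sup_bot_eq]
    exact ⟨c⟩
  | succ k ih =>
  obtain ⟨c', i, u, u₁, hu, hi, hc'⟩ :=
    c.exists_mem_missing_le_card_erase (card_pos.1 (by omega)) hN hc
  obtain ⟨hiC, hiu⟩ := mem_missing.1 hi
  simp only [← missing_eraseColor _ hiC] at hc'
  obtain ⟨d⟩ := ih (c'.eraseColor i hiC) (fun y h => hv y h.1)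
    (by rw [card_erase_of_mem hiC, card_erase_of_mem hu]; omega) hc'
    (by rw [card_erase_of_mem hu, hk, Nat.add_sub_cancel])
  exact c'.nonempty_sup_between_of_eraseColor hiC hu hiu hv d

end EdgeColoring

/-- **Vizing's theorem**. -/
theorem nonempty_edgeColoring [Finite V] (H : SimpleGraph V) (C : Finset ι)
    (hC : ∀ v, (H.neighborSet v).ncard < #C) : Nonempty (EdgeColoring H C) := by
  classical
  induction H using WellFoundedLT.induction with
  | _ H ih =>
  by_cases hH : ∃ v u, H.Adj v u
  · obtain ⟨v, u, hvu⟩ := hH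
    let N : Finset V := (H.neighborSet v).toFinite.toFinset
    have mem_N {x : V} : x ∈ N ↔ H.Adj v x := Set.Finite.mem_toFinset _
    have hlt : H.deleteIncidenceSet v < H := (H.deleteIncidenceSet_le v).lt_of_not_ge fun h =>
      (SimpleGraph.deleteIncidenceSet_adj.1 (h hvu)).2.1 rfl
    obtain ⟨c⟩ := ih _ hlt fun x => (Set.ncard_le_ncard fun y h => hlt.le h).trans_lt (hC x)
    have hgraph : H = H.deleteIncidenceSet v ⊔ (⊤ : SimpleGraph V).between {v} N := by
      rw [Set.Finite.coe_toFinset, deleteIncidenceSet_sup_between_neighborSet]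
    rw [hgraph]
    refine c.nonempty_sup_between (u₀ := v)
      (fun y h => (SimpleGraph.deleteIncidenceSet_adj.1 h).2.1 rfl) ?_ fun x hx => ?_
    · rw [← Set.ncard_eq_toFinset_card]
      exact (hC v).le
    · have hvx := mem_N.1 hx
      have hdeg : ((H.deleteIncidenceSet v).neighborSet x).ncard < (H.neighborSet x).ncard :=
        Set.ncard_lt_ncard (Set.ssubset_iff_exists.2 ⟨fun y h => hlt.le h, v, hvx.symm,
          fun h => (SimpleGraph.deleteIncidenceSet_adj.1 h).2.2 rfl⟩)
      have := c.card_missing_add_ncard_neighborSet x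
      have := hC x
      rw [if_neg hvx.ne']
      omega
  · push Not at hH
    exact ⟨⟨fun _ => id, fun _ _ => rfl, fun _ h => absurd rfl h, fun h => absurd h (hH _ _)⟩⟩

end Vizing

section Weight

variable {V : Type*} [Finite V] (w : Sym2 V → ℝ)

theorem weight_eq_sum_ite {S T : Set (Sym2 V)} [DecidablePred (· ∈ T)] (hT : T ⊆ S) :
    weight w T = ∑ e ∈ S.toFinite.toFinset, if e ∈ T then w e else 0 := by
  rw [weight, ← sum_filter]
  congr 1
  ext e
  simpa using @hT e

theorem sum_weight_eq {κ : Type*} {s : Finset κ} {S K : Set (Sym2 V)} {T : κ → Set (Sym2 V)}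
    [DecidablePred (· ∈ K)] [∀ e, DecidablePred fun i => e ∈ T i] (hT : ∀ i ∈ s, T i ⊆ S)
    (hK : K ⊆ S) {p r : ℝ}
    (hcount : ∀ e ∈ S, (#{i ∈ s | e ∈ T i} : ℝ) = if e ∈ K then p else r) :
    ∑ i ∈ s, weight w (T i) = p * weight w K + r * (weight w S - weight w K) := by
  classical
  calc ∑ i ∈ s, weight w (T i)
      = ∑ i ∈ s, ∑ e ∈ S.toFinite.toFinset, if e ∈ T i then w e else 0 :=
        sum_congr rfl fun i hi => weight_eq_sum_ite w (hT i hi)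
    _ = ∑ e ∈ S.toFinite.toFinset, (if e ∈ K then p else r) * w e := by
        rw [sum_comm]
        refine sum_congr rfl fun e he => ?_
        rw [← sum_filter, sum_const, nsmul_eq_mul, hcount e ((Set.Finite.mem_toFinset _).1 he)]
    _ = p * weight w K + r * (weight w S - weight w K) := by
        rw [weight_eq_sum_ite w hK, weight, ← sum_sub_distrib, mul_sum, mul_sum,
          ← sum_add_distrib]
        refine sum_congr rfl fun e _ => ?_
        split_ifs <;> ring

end Weight

section FiberGraph

variable {V κ : Type*} {G : SimpleGraph V} {f : V → κ}

/-- The subgraph of `G` formed by the edges whose ends have the same image under `f`. -/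
def fiberGraph (G : SimpleGraph V) (f : V → κ) : SimpleGraph V where
  Adj x y := G.Adj x y ∧ f x = f y
  symm := ⟨fun _ _ h => ⟨h.1.symm, h.2.symm⟩⟩
  loopless := ⟨fun _ h => h.1.ne rfl⟩

theorem fiberGraph_adj {x y : V} : (fiberGraph G f).Adj x y ↔ G.Adj x y ∧ f x = f y :=
  Iff.rfl

theorem fiberGraph_le : fiberGraph G f ≤ G := fun _ _ h => h.1

theorem colorable_fiberGraph {n : ℕ} (h : ∀ c, (G.induce (f ⁻¹' {c})).Colorable n) :
    (fiberGraph G f).Colorable n := by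
  let col (c : κ) : (G.induce (f ⁻¹' {c})).Coloring (Fin n) := (h c).some
  refine ⟨SimpleGraph.Coloring.mk (fun x => col (f x) ⟨x, rfl⟩) ?_⟩
  rintro x y ⟨hadj, hxy⟩
  have hcol {c : κ} (hc : f y = c) : col (f y) ⟨y, rfl⟩ = col c ⟨y, hc⟩ := by
    subst hc
    rfl
  rw [hcol hxy.symm]
  exact (col (f x)).valid hadj

theorem two_mul_card_xor_ne [Fintype κ] [DecidableEq κ] {p q : κ} (hpq : p ≠ q) (b b' : Bool) :
    2 * #{s : κ → Bool | (b ^^ s p) ≠ (b' ^^ s q)} = Fintype.card (κ → Bool) := by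
  let flip : Equiv.Perm (κ → Bool) :=
    Equiv.piCongrRight fun k => if k = p then Equiv.boolNot else 1
  have hflip : #{s : κ → Bool | (b ^^ s p) ≠ (b' ^^ s q)} =
      #{s : κ → Bool | ¬ (b ^^ s p) ≠ (b' ^^ s q)} := by
    refine card_equiv flip fun s => ?_
    have hp : flip s p = !s p := by simp [flip]
    have hq : flip s q = s q := by simp [flip, hpq.symm]
    rw [mem_filter_univ, mem_filter_univ, hp, hq]
    rw [Bool.xor_not]
    cases b ^^ s p <;> cases b' ^^ s q <;> decide
  rw [two_mul]
  nth_rw 2 [hflip]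
  rw [card_filter_add_card_filter_not, card_univ]

theorem weight_add_weight_fiberGraph_le [Finite V] [Finite κ]
    (hbip : (fiberGraph G f).IsBipartite) (w : Sym2 V → ℝ) :
    weight w G.edgeSet + weight w (fiberGraph G f).edgeSet ≤ 2 * mac G w := by
  classical
  have := Fintype.ofFinite κ
  let b : (fiberGraph G f).Coloring Bool := hbip.toColoring (by simp)
  let A (s : κ → Bool) : Set V := {x | (b x ^^ s (f x)) = true}
  set N : ℝ := (Fintype.card (κ → Bool) : ℝ)
  have mem_cut (s : κ → Bool) (x y : V) : (G.between (A s) (A s)ᶜ).Adj x y ↔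
      G.Adj x y ∧ (b x ^^ s (f x)) ≠ (b y ^^ s (f y)) := by
    simp only [SimpleGraph.between_adj, Set.mem_compl_iff, A, Set.mem_ofPred_eq]
    cases b x ^^ s (f x) <;> cases b y ^^ s (f y) <;> simp
  have hsum : ∑ s, cutWeight G w (A s) = N * weight w (fiberGraph G f).edgeSet +
      N / 2 * (weight w G.edgeSet - weight w (fiberGraph G f).edgeSet) := by
    refine sum_weight_eq w (fun s _ => SimpleGraph.edgeSet_mono SimpleGraph.between_le)
      (SimpleGraph.edgeSet_mono fiberGraph_le) fun e he => ?_
    induction e using Sym2.ind with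
    | _ x y =>
    have hxy : G.Adj x y := he
    simp only [SimpleGraph.mem_edgeSet, mem_cut, fiberGraph_adj, hxy, true_and]
    split_ifs with hf
    · have hne : b x ≠ b y := b.valid ⟨hxy, hf⟩
      simp [hf, hne, N]
    · simp only [N, ← two_mul_card_xor_ne hf (b x) (b y), Nat.cast_mul, Nat.cast_ofNat]
      ring
  have hle : ∑ s, cutWeight G w (A s) ≤ N * mac G w := by
    rw [← nsmul_eq_mul, ← card_univ]
    exact sum_le_card_nsmul _ _ _ fun s _ => (isGreatest_mac G w).2 ⟨A s, rfl⟩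
  have hN : 0 < N := by positivity
  nlinarith

end FiberGraph

section Bipartite

variable {V : Type*}

theorem isBipartite_mateGraph {m : V → V} (hm : Involutive m) : (mateGraph m).IsBipartite := by
  classical
  let := linearOrderOfSTO (WellOrderingRel (α := V))
  refine (SimpleGraph.Coloring.mk (fun x => decide (x < m x)) fun {x y} h => ?_).colorable
  obtain ⟨hne, rfl⟩ := (mateGraph_adj hm).1 h
  rw [hm x]
  grind

theorem isBipartite_of_subsingleton_neighborSet {K : SimpleGraph V}
    (hK : ∀ x, (K.neighborSet x).Subsingleton) : K.IsBipartite := by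
  obtain ⟨m, hm, rfl⟩ := exists_involutive_mateGraph_eq K hK
  exact isBipartite_mateGraph hm

theorem isBipartite_of_cliqueFree_three_of_card_le_four [Finite V] {G : SimpleGraph V}
    (hG : G.CliqueFree 3) (hV : Nat.card V ≤ 4) : G.IsBipartite := by
  classical
  have triangle_free {x y z : V} (hxy : G.Adj x y) (hyz : G.Adj y z) : ¬ G.Adj x z := fun hxz =>
    hG {x, y, z} (SimpleGraph.is3Clique_triple_iff.2 ⟨hxy, hxz, hyz⟩)
  by_cases hsub : ∀ x, (G.neighborSet x).Subsingleton
  · exact isBipartite_of_subsingleton_neighborSet hsub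
  push Not at hsub
  obtain ⟨v, a, ha, b, hb, hab⟩ := hsub
  refine (SimpleGraph.Coloring.mk (fun x => decide (G.Adj v x)) fun {x y} hxy heq => ?_).colorable
  rw [decide_eq_decide] at heq
  by_cases hvx : G.Adj v x
  · exact triangle_free hvx hxy (heq.1 hvx)
  have := Fintype.ofFinite V
  have hvy : ¬ G.Adj v y := mt heq.2 hvx
  have hcard : #{v, a, b, x, y} = 5 := by
    grind [SimpleGraph.Adj.ne, SimpleGraph.Adj.symm, SimpleGraph.mem_neighborSet]
  have := card_le_univ ({v, a, b, x, y} : Finset V)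
  rw [Nat.card_eq_fintype_card] at hV
  omega

theorem isBipartite_fiberGraph [Finite V] {κ : Type*} {G : SimpleGraph V} (hG : G.CliqueFree 3)
    {f : V → κ} (hf : ∀ c, (f ⁻¹' {c}).ncard ≤ 4) : (fiberGraph G f).IsBipartite :=
  colorable_fiberGraph fun c => isBipartite_of_cliqueFree_three_of_card_le_four
    (hG.comap (SimpleGraph.Embedding.induce _).isContained) (hf c)

theorem weight_le_mac_of_isBipartite [Finite V] {G : SimpleGraph V}
    (hG : G.IsBipartite) (w : Sym2 V → ℝ) : weight w G.edgeSet ≤ mac G w := by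
  have hfiber : fiberGraph G (fun _ => ()) = G := by
    ext x y
    simp [fiberGraph_adj]
  have := weight_add_weight_fiberGraph_le (hfiber.symm ▸ hG) w
  rw [hfiber] at this
  linarith

end Bipartite

section Contraction

variable {V W ι : Type*} {G : SimpleGraph V} {q : V → W} {C : Finset ι}

theorem card_filter_mateBlock_comp_eq [DecidableEq W] (c : EdgeColoring (G.map q) C) {x y : V}
    (hxy : G.Adj x y) :
    #{i ∈ C | mateBlock (c.mate i) (q x) = mateBlock (c.mate i) (q y)} =
      if q x = q y then #C else 1 := by
  split_ifs with hq
  · simp only [hq, filter_true]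
  · obtain ⟨i, hi, huniq⟩ :=
      c.existsUnique_mate_eq ((SimpleGraph.map_adj' ..).2 ⟨hq, x, y, hxy, rfl, rfl⟩)
    rw [card_eq_one]
    refine ⟨i, ?_⟩
    ext j
    simp only [mem_filter, mateBlock_eq_iff (c.involutive j), hq, false_or, mem_singleton]
    exact ⟨huniq j, fun h => h ▸ hi⟩

theorem weight_add_weight_fiberGraph_le_of_edgeColoring [Finite V] [Finite W] (hG : G.CliqueFree 3)
    (hq : ∀ x, (q ⁻¹' {x}).ncard ≤ 2) (c : EdgeColoring (G.map q) C) (w : Sym2 V → ℝ) :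
    (#C + 1) * weight w G.edgeSet + (#C - 1) * weight w (fiberGraph G q).edgeSet ≤
      2 * #C * mac G w := by
  classical
  have hsum : ∑ i ∈ C, weight w (fiberGraph G (mateBlock (c.mate i) ∘ q)).edgeSet =
      #C * weight w (fiberGraph G q).edgeSet +
        1 * (weight w G.edgeSet - weight w (fiberGraph G q).edgeSet) := by
    refine sum_weight_eq w (fun i _ => SimpleGraph.edgeSet_mono fiberGraph_le)
      (SimpleGraph.edgeSet_mono fiberGraph_le) fun e he => ?_
    induction e using Sym2.ind with
    | _ x y =>
    have hxy : G.Adj x y := he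
    simp only [SimpleGraph.mem_edgeSet, fiberGraph_adj, hxy, true_and, comp_apply,
      card_filter_mateBlock_comp_eq c hxy, Nat.cast_ite, Nat.cast_one]
  have hle : ∀ i ∈ C, weight w G.edgeSet +
      weight w (fiberGraph G (mateBlock (c.mate i) ∘ q)).edgeSet ≤ 2 * mac G w := fun i _ =>
    weight_add_weight_fiberGraph_le
      (isBipartite_fiberGraph hG (ncard_preimage_mateBlock_comp_le q hq (c.mate i))) w
  have := sum_le_card_nsmul C _ _ hle
  rw [sum_add_distrib, hsum, sum_const, nsmul_eq_mul, nsmul_eq_mul] at this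
  linarith

theorem fiberGraph_mateBlock {m : V → V} (hm : Involutive m) (hle : mateGraph m ≤ G) :
    fiberGraph G (mateBlock m) = mateGraph m := by
  ext x y
  rw [fiberGraph_adj, mateBlock_eq_iff hm]
  constructor
  · rintro ⟨h, h'⟩
    exact (mateGraph_adj hm).2 ⟨h.ne, h'.resolve_left h.ne⟩
  · exact fun h => ⟨hle h, Or.inr ((mateGraph_adj hm).1 h).2⟩

theorem ncard_neighborSet_map_mateBlock_le [Finite V] {m : V → V} (hm : Involutive m)
    (hle : mateGraph m ≤ G) {Δ : ℕ} (hΔ : ∀ x, (G.neighborSet x).ncard ≤ Δ) (h2 : 2 ≤ Δ)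
    (P : Sym2 V) : ((G.map (mateBlock m)).neighborSet P).ncard ≤ 2 * Δ - 2 := by
  obtain hempty | ⟨Q, hQ⟩ := ((G.map (mateBlock m)).neighborSet P).eq_empty_or_nonempty
  · rw [hempty, Set.ncard_empty]
    exact Nat.zero_le _
  obtain ⟨-, x, -, -, rfl, -⟩ := (SimpleGraph.map_adj' ..).1 hQ
  have hsub : (G.map (mateBlock m)).neighborSet (mateBlock m x) ⊆
      mateBlock m '' (G.neighborSet x \ {m x} ∪ G.neighborSet (m x) \ {x}) := by
    intro R hR
    obtain ⟨hne, y, z, hyz, hy, rfl⟩ := (SimpleGraph.map_adj' ..).1 hR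
    refine ⟨z, ?_, rfl⟩
    rw [Ne, mateBlock_eq_iff hm] at hne
    rw [eq_comm, mateBlock_eq_iff hm] at hy
    grind [SimpleGraph.mem_neighborSet]
  refine (Set.ncard_le_ncard hsub).trans ((Set.ncard_image_le).trans ?_)
  by_cases hx : m x = x
  · rw [hx, Set.union_self]
    exact (Set.ncard_le_ncard Set.sdiff_subset).trans ((hΔ x).trans (by omega))
  · have hadj : G.Adj x (m x) := hle ((mateGraph_adj hm).2 ⟨Ne.symm hx, rfl⟩)
    have h₁ := Set.ncard_sdiff_singleton_add_one (show m x ∈ G.neighborSet x from hadj)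
    have h₂ := Set.ncard_sdiff_singleton_add_one (show x ∈ G.neighborSet (m x) from hadj.symm)
    have h₃ := Set.ncard_union_le (G.neighborSet x \ {m x}) (G.neighborSet (m x) \ {x})
    have := hΔ x
    have := hΔ (m x)
    omega

theorem weight_add_weight_mateGraph_le [Finite V] (hG : G.CliqueFree 3) {Δ : ℕ} (h2 : 2 ≤ Δ)
    (hΔ : ∀ x, (G.neighborSet x).ncard ≤ Δ) {m : V → V} (hm : Involutive m)
    (hle : mateGraph m ≤ G) (w : Sym2 V → ℝ) :
    2 * Δ * weight w G.edgeSet + (2 * Δ - 2) * weight w (mateGraph m).edgeSet ≤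
      2 * (2 * Δ - 1) * mac G w := by
  obtain ⟨c⟩ := nonempty_edgeColoring (G.map (mateBlock m)) (range (2 * Δ - 1)) fun P => by
    have := ncard_neighborSet_map_mateBlock_le hm hle hΔ h2 P
    rw [card_range]
    omega
  have hblock : ∀ P, (mateBlock m ⁻¹' {P}).ncard ≤ 2 := fun P => by
    simpa using ncard_preimage_mateBlock_comp_le id (k := 1) (by simp) m P
  have hbound := weight_add_weight_fiberGraph_le_of_edgeColoring hG hblock c w
  rw [fiberGraph_mateBlock hm hle, card_range, Nat.cast_sub (by omega)] at hbound
  push_cast at hbound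
  linarith

end Contraction

end MaxCut

open MaxCut in
theorem mainTheorem4_general {V : Type*} [Fintype V] (G : SimpleGraph V) [DecidableRel G.Adj]
    (w : Sym2 V → ℝ) (hG : G.CliqueFree 3) (Δ : ℕ) (hΔ : G.maxDegree ≤ Δ)
    (M : G.Subgraph) (hM : M.IsMatching) :
    mac G w ≥
      (Δ : ℝ) / (2 * (Δ : ℝ) - 1) * (weight w G.edgeSet - weight w M.edgeSet)
        + weight w M.edgeSet := by
  have hdeg : ∀ x, (G.neighborSet x).ncard ≤ Δ := fun x => by
    rw [Set.ncard_eq_toFinset_card', Set.toFinset_card, SimpleGraph.card_neighborSet_eq_degree]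
    exact (G.degree_le_maxDegree x).trans hΔ
  obtain ⟨m, hm, hmM⟩ := exists_involutive_mateGraph_eq M.spanningCoe
    fun x y hy z hz => hM.eq_of_adj_left hy hz
  have hle : mateGraph m ≤ G := hmM ▸ M.spanningCoe_le
  rw [← M.edgeSet_spanningCoe, ← hmM]
  obtain h2 | h2 := le_or_gt 2 Δ
  · have hpos : (0 : ℝ) < 2 * Δ - 1 := by
      have : (2 : ℝ) ≤ Δ := mod_cast h2
      linarith
    rw [ge_iff_le, ← le_sub_iff_add_le, div_mul_eq_mul_div, div_le_iff₀ hpos]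
    linarith [weight_add_weight_mateGraph_le hG h2 hdeg hm hle w]
  · have hsub : ∀ x, (G.neighborSet x).Subsingleton := fun x =>
      Set.ncard_le_one_iff_subsingleton.1 ((hdeg x).trans (by omega))
    have hmac := weight_le_mac_of_isBipartite (isBipartite_of_subsingleton_neighborSet hsub) w
    interval_cases Δ
    · have hge : G ≤ mateGraph m := fun x y h =>
        absurd (hdeg x) ((Set.ncard_pos (Set.toFinite _)).2 ⟨y, h⟩).not_ge
      simpa [hle.antisymm hge] using hmac
    · norm_num
      exact hmac

theorem mainTheorem4 {V : Type*} [Fintype V] (G : SimpleGraph V) [DecidableRel G.Adj]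
    (w : Sym2 V → ℝ) (hw : ∀ e ∈ G.edgeSet, 0 ≤ w e)
    (hG : G.CliqueFree 3) (Δ : ℕ) (hΔ : G.maxDegree ≤ Δ)
    (M : G.Subgraph) (hM : M.IsMatching) :
    MaxCut.mac G w ≥
      (Δ : ℝ) / (2 * (Δ : ℝ) - 1) * (MaxCut.weight w G.edgeSet - MaxCut.weight w M.edgeSet)
        + MaxCut.weight w M.edgeSet :=
  mainTheorem4_general G w hG Δ hΔ M hM
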